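/- **Theorem 2.1.** Let $(P,g)$ and $(M,h)$ be smooth Riemannian manifolds (without boundary) of dimensions $n+1$ and $n$, and let $\pi:(P,g)\to(M,h)$ be a Riemannian submersion, i.e. $\pi$ is smooth and surjective, and for every $u\in P$ the differential $d\pi_u:T_uP\to T_{\pi(u)}M$ is surjective and restricts to an isometry from the horizontal subspace $\mathcal H_u=(\ker d\pi_u)^{\perp}$ onto $T_{\pi(u)}M$; thus the fibres of $\pi$ are one-dimensional. Let $\nabla$ and $\nabla^h$ be the Levi-Civita connections of $(P,g)$ and $(M,h)$, let $\overline\nabla$ be the connection induced by $\nabla^h$ on $\pi^{-1}TM$, let $$B(\pi)(X,Y)=\overline\nabla_X(d\pi(Y))-d\pi(\nabla_XY)$$ be the second fundamental form of $\pi$, and let $\tau(\pi)=\sum_{i=1}^{n+1}B(\pi)(f_i,f_i)$ be its tension field, where $f_1,\dots,f_{n+1}$ is any local orthonormal frame field of $(P,g)$. Let $U\subseteq P$ and $V\subseteq M$ be open with $\pi(U)\subseteq V$, let $\epsilon_1,\dots,\epsilon_n$ be a smooth orthonormal frame field of $(M,h)$ on $V$, and let $e_1,\dots,e_{n+1}$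 be a smooth orthonormal frame field of $(P,g)$ on $U$ adapted to $\pi$: for $1\le i\le n$ the field $e_i$ is horizontal with $d\pi(e_i)=\epsilon_i\circ\pi$ on $U$, and $e_{n+1}$ is vertical, $d\pi(e_{n+1})=0$. Then there are functions $\kappa_1,\dots,\kappa_n\in C^\infty(U)$ with $$[e_i,e_{n+1}]=\kappa_i\,e_{n+1}\qquad(i=1,\dots,n)$$ on $U$, and the tension field of $\pi$ is given on $U$ by $$\tau(\pi)=-d\pi\left(\nabla_{e_{n+1}}e_{n+1}\right)=-\sum_{i=1}^n\kappa_i\,(\epsilon_i\circ\pi).$$ -/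

import Mathlib

open Bundle Manifold ContDiff

noncomputable section

namespace RiemSub

set_option linter.unusedSectionVars false

section LeviCivita

variable {E : Type*} [NormedAddCommGroup E] [NormedSpace ℝ E] [FiniteDimensional ℝ E]
  {H : Type*} [TopologicalSpace H] (I : ModelWithCorners ℝ E H)
  {M : Type*} [TopologicalSpace M] [ChartedSpace H M] [IsManifold I ∞ M]
  [RiemannianBundle (fun x : M ↦ TangentSpace I x)]
  [IsContMDiffRiemannianBundle I ∞ E (fun x : M ↦ TangentSpace I x)]

/-- The right hand side of the Koszul formula, `g(∇_X Y, Z)` at the point `x`: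
`½ (X g(Y,Z) + Y g(Z,X) - Z g(X,Y) + g([X,Y],Z) - g([Y,Z],X) + g([Z,X],Y))`. -/
def koszul (X Y Z : Π x : M, TangentSpace I x) (x : M) : ℝ :=
  (1 / 2 : ℝ) *
    (mvfderiv I (fun y ↦ inner ℝ (Y y) (Z y)) x (X x)
      + mvfderiv I (fun y ↦ inner ℝ (Z y) (X y)) x (Y x)
      - mvfderiv I (fun y ↦ inner ℝ (X y) (Y y)) x (Z x)
      + inner ℝ (VectorField.mlieBracket I X Y x) (Z x)
      - inner ℝ (VectorField.mlieBracket I Y Z x) (X x)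
      + inner ℝ (VectorField.mlieBracket I Z X x) (Y x))

instance finiteDimensional_tangentSpace (x : M) : FiniteDimensional ℝ (TangentSpace I x) :=
  inferInstanceAs (FiniteDimensional ℝ E)

theorem mdifferentiableAt_inner {x : M} {Y Z : Π x : M, TangentSpace I x}
    (hY : MDiffAt (T% Y) x) (hZ : MDiffAt (T% Z) x) :
    MDiffAt (fun y ↦ (inner ℝ (Y y) (Z y) : ℝ)) x :=
  MDifferentiableAt.inner_bundle (IB := I) (F := E) (E := fun x : M ↦ TangentSpace I x)
    (b := fun y ↦ y) (v := Y) (w := Z) hY hZ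

theorem koszul_tensorial_left {x : M} {Y Z : Π x : M, TangentSpace I x}
    (hY : MDiffAt (T% Y) x) (hZ : MDiffAt (T% Z) x) :
    TensorialAt I E (fun X ↦ koszul I X Y Z x) x where
  smul {f X} hf hX := by
    have h1 := mvfderiv_fun_mul hf (mdifferentiableAt_inner I hZ hX)
    have h2 := mvfderiv_fun_mul hf (mdifferentiableAt_inner I hX hY)
    have h3 := VectorField.mlieBracket_smul_left (W := Y) hf hX
    have h4 := VectorField.mlieBracket_smul_right (V := Z) hf hX
    simp [koszul, h1, h2, h3, h4, inner_add_left, inner_smul_left, inner_smul_right]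
    rw [real_inner_comm (Z x) (X x)]
    ring
  add {X X'} hX hX' := by
    have h1 := mvfderiv_fun_add (mdifferentiableAt_inner I hZ hX) (mdifferentiableAt_inner I hZ hX')
    have h2 := mvfderiv_fun_add (mdifferentiableAt_inner I hX hY) (mdifferentiableAt_inner I hX' hY)
    have h3 := VectorField.mlieBracket_add_left (W := Y) hX hX'
    have h4 := VectorField.mlieBracket_add_right (V := Z) hX hX'
    simp [koszul, h1, h2, h3, h4, inner_add_left, inner_add_right]
    ring

theorem koszul_tensorial_right {x : M} {X Y : Π x : M, TangentSpace I x}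
    (hX : MDiffAt (T% X) x) (hY : MDiffAt (T% Y) x) :
    TensorialAt I E (fun Z ↦ koszul I X Y Z x) x where
  smul {f Z} hf hZ := by
    have h1 := mvfderiv_fun_mul hf (mdifferentiableAt_inner I hY hZ)
    have h2 := mvfderiv_fun_mul hf (mdifferentiableAt_inner I hZ hX)
    have h3 := VectorField.mlieBracket_smul_left (W := X) hf hZ
    have h4 := VectorField.mlieBracket_smul_right (V := Y) hf hZ
    simp [koszul, h1, h2, h3, h4, inner_add_left, inner_smul_left, inner_smul_right]
    rw [real_inner_comm (Y x) (Z x)]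
    ring
  add {Z Z'} hZ hZ' := by
    have h1 := mvfderiv_fun_add (mdifferentiableAt_inner I hY hZ) (mdifferentiableAt_inner I hY hZ')
    have h2 := mvfderiv_fun_add (mdifferentiableAt_inner I hZ hX) (mdifferentiableAt_inner I hZ' hX)
    have h3 := VectorField.mlieBracket_add_left (W := X) hZ hZ'
    have h4 := VectorField.mlieBracket_add_right (V := Y) hZ hZ'
    simp [koszul, h1, h2, h3, h4, inner_add_left, inner_add_right]
    ring

/-- The bilinear form `(v, w) ↦ g(∇_v Y, w)` on the tangent space at `x`, for a vector field `Y`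
that is differentiable at `x`. -/
def koszulForm (Y : Π x : M, TangentSpace I x) {x : M} (hY : MDiffAt (T% Y) x) :
    TangentSpace I x →L[ℝ] TangentSpace I x →L[ℝ] ℝ :=
  TensorialAt.mkHom₂ (fun X Z ↦ koszul I X Y Z x) x
    (fun _ hZ ↦ koszul_tensorial_left I hY hZ) (fun _ hX ↦ koszul_tensorial_right I hX hY)

open scoped Classical in
/-- The Levi-Civita connection as an operation: `leviCivitaFun I Y x v` is `∇_v Y`, the vector at
`x` determined by the Koszul formula `g(∇_v Y, w) = koszulForm v w`, expanded in an orthonormal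
basis of the tangent space. (A vector field that is not differentiable at `x` gets the value `0`.)
-/
def leviCivitaFun (Y : Π x : M, TangentSpace I x) (x : M) :
    TangentSpace I x →L[ℝ] TangentSpace I x :=
  if hY : MDiffAt (T% Y) x then
    ∑ i, ((koszulForm I Y hY).flip (stdOrthonormalBasis ℝ (TangentSpace I x) i)).smulRight
      (stdOrthonormalBasis ℝ (TangentSpace I x) i)
  else 0

theorem inner_leviCivitaFun {x : M} {X Y Z : Π x : M, TangentSpace I x}
    (hX : MDiffAt (T% X) x) (hY : MDiffAt (T% Y) x) (hZ : MDiffAt (T% Z) x) :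
    inner ℝ (leviCivitaFun I Y x (X x)) (Z x) = koszul I X Y Z x := by
  have h := TensorialAt.mkHom₂_apply (Φ := fun X Z ↦ koszul I X Y Z x)
    (fun _ hZ ↦ koszul_tensorial_left I hY hZ) (fun _ hX ↦ koszul_tensorial_right I hX hY) hX hZ
  rw [← h]
  change _ = koszulForm I Y hY (X x) (Z x)
  conv_rhs => rw [← (stdOrthonormalBasis ℝ (TangentSpace I x)).sum_repr' (Z x)]
  simp only [leviCivitaFun, hY, dite_true]
  simp [sum_inner, inner_smul_left, mul_comm]

/-- The Levi-Civita connection of a Riemannian manifold. -/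
def leviCivita : CovariantDerivative I E (fun x : M ↦ TangentSpace I x) where
  toFun := leviCivitaFun I
  isCovariantDerivativeOnUniv :=
  { add := by
      intro Y Y' x hY hY' _
      ext1 v
      refine ext_inner_right ℝ fun w ↦ ?_
      have hX := FiberBundle.mdifferentiableAt_extend I E v
      have hZ := FiberBundle.mdifferentiableAt_extend I E w
      have e := inner_leviCivitaFun I hX (mdifferentiableAt_add_section hY hY') hZ
      have e1 := inner_leviCivitaFun I hX hY hZ
      have e2 := inner_leviCivitaFun I hX hY' hZ
      simp only [FiberBundle.extend_apply_self] at e e1 e2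
      rw [e, add_apply, inner_add_left, e1, e2]
      have h1 := mvfderiv_fun_add (mdifferentiableAt_inner I hY hZ)
        (mdifferentiableAt_inner I hY' hZ)
      have h2 := mvfderiv_fun_add (mdifferentiableAt_inner I hX hY)
        (mdifferentiableAt_inner I hX hY')
      have h3 := VectorField.mlieBracket_add_left (W := FiberBundle.extend E w) hY hY'
      have h4 := VectorField.mlieBracket_add_right (V := FiberBundle.extend E v) hY hY'
      simp [koszul, h1, h2, h3, h4, inner_add_left, inner_add_right]
      ring
    leibniz := by
      intro Y f x hY hf _
      ext1 v
      refine ext_inner_right ℝ fun w ↦ ?_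
      have hX := FiberBundle.mdifferentiableAt_extend I E v
      have hZ := FiberBundle.mdifferentiableAt_extend I E w
      have e := inner_leviCivitaFun I hX (hf.smul_section hY) hZ
      have e1 := inner_leviCivitaFun I hX hY hZ
      simp only [FiberBundle.extend_apply_self] at e e1
      change inner ℝ (leviCivitaFun I (f • Y) x v) w = _ at e
      rw [e]
      simp only [add_apply, smul_apply, inner_add_left,
        inner_smul_left, e1]
      have h1 := mvfderiv_fun_mul hf (mdifferentiableAt_inner I hY hZ)
      have h2 := mvfderiv_fun_mul hf (mdifferentiableAt_inner I hX hY)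
      have h3 := VectorField.mlieBracket_smul_left (W := FiberBundle.extend E w) hf hY
      have h4 := VectorField.mlieBracket_smul_right (V := FiberBundle.extend E v) hf hY
      simp [koszul, h1, h2, h3, h4, inner_add_left, inner_smul_left, inner_smul_right]
      rw [real_inner_comm v (Y x)]
      ring }

theorem leviCivita_metric {x : M} {X Y Z : Π x : M, TangentSpace I x}
    (hX : MDiffAt (T% X) x) (hY : MDiffAt (T% Y) x) (hZ : MDiffAt (T% Z) x) :
    mvfderiv I (fun y ↦ (inner ℝ (Y y) (Z y) : ℝ)) x (X x) =
      inner ℝ (leviCivita I Y x (X x)) (Z x) + inner ℝ (Y x) (leviCivita I Z x (X x)) := by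
  have e1 := inner_leviCivitaFun I hX hY hZ
  have e2 := inner_leviCivitaFun I hX hZ hY
  rw [real_inner_comm (leviCivita I Z x (X x)) (Y x)]
  change _ = inner ℝ (leviCivitaFun I Y x (X x)) (Z x) + inner ℝ (leviCivitaFun I Z x (X x)) (Y x)
  rw [e1, e2]
  simp only [koszul]
  have c1 : (fun y ↦ (inner ℝ (Z y) (X y) : ℝ)) = fun y ↦ inner ℝ (X y) (Z y) :=
    funext fun y ↦ real_inner_comm _ _
  have c2 : (fun y ↦ (inner ℝ (Z y) (Y y) : ℝ)) = fun y ↦ inner ℝ (Y y) (Z y) :=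
    funext fun y ↦ real_inner_comm _ _
  have c3 : (fun y ↦ (inner ℝ (Y y) (X y) : ℝ)) = fun y ↦ inner ℝ (X y) (Y y) :=
    funext fun y ↦ real_inner_comm _ _
  rw [c1, c2, c3, VectorField.mlieBracket_swap_apply (V := Y) (W := X),
    VectorField.mlieBracket_swap_apply (V := Z) (W := X),
    VectorField.mlieBracket_swap_apply (V := Z) (W := Y)]
  simp only [inner_neg_left]
  ring

theorem leviCivita_torsion {x : M} {X Y : Π x : M, TangentSpace I x}
    (hX : MDiffAt (T% X) x) (hY : MDiffAt (T% Y) x) :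
    leviCivita I Y x (X x) - leviCivita I X x (Y x) = VectorField.mlieBracket I X Y x := by
  refine ext_inner_right ℝ fun w ↦ ?_
  have hZ := FiberBundle.mdifferentiableAt_extend I E w
  have e1 := inner_leviCivitaFun I hX hY hZ
  have e2 := inner_leviCivitaFun I hY hX hZ
  simp only [FiberBundle.extend_apply_self] at e1 e2
  change inner ℝ (leviCivitaFun I Y x (X x) - leviCivitaFun I X x (Y x)) w = _
  rw [inner_sub_left, e1, e2]
  simp only [koszul]
  have c1 : (fun y ↦ (inner ℝ (FiberBundle.extend E w y) (X y) : ℝ)) =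
    fun y ↦ inner ℝ (X y) (FiberBundle.extend E w y) := funext fun y ↦ real_inner_comm _ _
  have c2 : (fun y ↦ (inner ℝ (FiberBundle.extend E w y) (Y y) : ℝ)) =
    fun y ↦ inner ℝ (Y y) (FiberBundle.extend E w y) := funext fun y ↦ real_inner_comm _ _
  have c3 : (fun y ↦ (inner ℝ (Y y) (X y) : ℝ)) =
    fun y ↦ inner ℝ (X y) (Y y) := funext fun y ↦ real_inner_comm _ _
  rw [c1, c2, c3, VectorField.mlieBracket_swap_apply (V := Y) (W := X),
    VectorField.mlieBracket_swap_apply (V := FiberBundle.extend E w) (W := X),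
    VectorField.mlieBracket_swap_apply (V := FiberBundle.extend E w) (W := Y)]
  simp [inner_neg_left]
  ring

end LeviCivita

section Tension

variable {E : Type*} [NormedAddCommGroup E] [NormedSpace ℝ E] [FiniteDimensional ℝ E]
  {H : Type*} [TopologicalSpace H] (I : ModelWithCorners ℝ E H)
  {M : Type*} [TopologicalSpace M] [ChartedSpace H M] [IsManifold I ∞ M]
  [RiemannianBundle (fun x : M ↦ TangentSpace I x)]
  [IsContMDiffRiemannianBundle I ∞ E (fun x : M ↦ TangentSpace I x)]
  {E' : Type*} [NormedAddCommGroup E'] [NormedSpace ℝ E'] [FiniteDimensional ℝ E']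
  {H' : Type*} [TopologicalSpace H'] (I' : ModelWithCorners ℝ E' H')
  {N : Type*} [TopologicalSpace N] [ChartedSpace H' N] [IsManifold I' ∞ N]
  [RiemannianBundle (fun x : N ↦ TangentSpace I' x)]
  [IsContMDiffRiemannianBundle I' ∞ E' (fun x : N ↦ TangentSpace I' x)]

/-- The connection `∇̄` induced on `φ⁻¹TN` by the Levi-Civita connection of `N`: the derivative
`∇̄_v V` at `p` of a section `V` of `φ⁻¹TN`. Write `V = ∑ j, V_j (s_j ∘ φ)` in the local frame
`s_j` of `TN` around `φ p` given by the preferred trivialization. Then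
`∇̄_v V = ∑ j, dV_j(v) s_j(φ p) + ∑ j, V_j(p) ∇_{dφ v} s_j`, where the last sum is the derivative of
the vector field `∑ j, V_j(p) s_j`, which is `FiberBundle.extend E' (V p)`. -/
def inducedDeriv (φ : M → N) (V : Π p : M, TangentSpace I' (φ p)) (p : M) (v : TangentSpace I p) :
    TangentSpace I' (φ p) :=
  (trivializationAt E' (TangentSpace I' : N → Type _) (φ p)).symmL ℝ (φ p)
      (mvfderiv I (fun q ↦ (trivializationAt E' (TangentSpace I' : N → Type _) (φ p)
        (⟨φ q, V q⟩ : TangentBundle I' N)).2) p v)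
    + leviCivita I' (FiberBundle.extend E' (V p)) (φ p) (mfderiv I I' φ p v)

/-- The second fundamental form `B(φ)(X,Y) = ∇̄_X (dφ(Y)) - dφ(∇_X Y)`. -/
def secondFundamentalForm (φ : M → N) (X Y : Π p : M, TangentSpace I p) (p : M) :
    TangentSpace I' (φ p) :=
  inducedDeriv I I' φ (fun q ↦ mfderiv I I' φ q (Y q)) p (X p)
    - mfderiv I I' φ p (leviCivita I Y p (X p))

/-- The tension field: the trace of `B(φ)` with respect to the metric of `M`. Since `B(φ)` is
tensorial, it is enough to sum over an orthonormal basis of the tangent space at `p`, extended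
arbitrarily; see `tensionField_eq_sum` for the formula in orthonormal frame fields. -/
def tensionField (φ : M → N) (p : M) : TangentSpace I' (φ p) :=
  ∑ i, secondFundamentalForm I I' φ
    (FiberBundle.extend E (stdOrthonormalBasis ℝ (TangentSpace I p) i))
    (FiberBundle.extend E (stdOrthonormalBasis ℝ (TangentSpace I p) i)) p

theorem leviCivita_extend_comb {y : N} (a b : ℝ) (v w : TangentSpace I' y) :
    leviCivita I' (FiberBundle.extend E' (a • v + b • w)) y =
      a • leviCivita I' (FiberBundle.extend E' v) y
        + b • leviCivita I' (FiberBundle.extend E' w) y := by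
  have hv := FiberBundle.mdifferentiableAt_extend I' E' v
  have hw := FiberBundle.mdifferentiableAt_extend I' E' w
  have hc := (leviCivita I' (M := N)).isCovariantDerivativeOn (s := Set.univ)
  have hav : MDiffAt (T% (a • FiberBundle.extend E' v)) y :=
    (mdifferentiableAt_const (c := a) (I := I') (x := y)).smul_section hv
  have hbw : MDiffAt (T% (b • FiberBundle.extend E' w)) y :=
    (mdifferentiableAt_const (c := b) (I := I') (x := y)).smul_section hw
  rw [← hc.smul_const a hv, ← hc.smul_const b hw, ← hc.add hav hbw]
  refine hc.congr_of_eventuallyEq (FiberBundle.mdifferentiableAt_extend I' E' _)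
    (mdifferentiableAt_add_section hav hbw) Filter.univ_mem ?_
  have hy := FiberBundle.mem_baseSet_trivializationAt' (F := E')
    (E := (TangentSpace I' : N → Type _)) y
  filter_upwards [(trivializationAt E' (TangentSpace I' : N → Type _) y).open_baseSet.mem_nhds hy]
    with z hz
  simp only [FiberBundle.extend, Pi.add_apply, Pi.smul_apply]
  simp only [← Trivialization.symmL_apply (R := ℝ) _ hz,
    ← Trivialization.continuousLinearMapAt_apply_of_mem (R := ℝ) _ hy, map_add, map_smul]

theorem mvfderiv_congr {F : Type*} [NormedAddCommGroup F] [NormedSpace ℝ F] {f g : M → F} {p : M}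
    (h : f =ᶠ[nhds p] g) : mvfderiv I f p = mvfderiv I g p := by
  ext v
  exact congrArg (fun L : E →L[ℝ] F ↦ L v) h.mfderiv_eq

theorem inducedDeriv_add {φ : M → N} {p : M} {V W : Π p : M, TangentSpace I' (φ p)}
    (hV : MDifferentiableAt I (I'.prod 𝓘(ℝ, E')) (fun q ↦ (⟨φ q, V q⟩ : TangentBundle I' N)) p)
    (hW : MDifferentiableAt I (I'.prod 𝓘(ℝ, E')) (fun q ↦ (⟨φ q, W q⟩ : TangentBundle I' N)) p)
    (v : TangentSpace I p) :
    inducedDeriv I I' φ (fun q ↦ V q + W q) p v =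
      inducedDeriv I I' φ V p v + inducedDeriv I I' φ W p v := by
  have hV' := ((mdifferentiableAt_totalSpace _ _).1 hV).2
  have hW' := ((mdifferentiableAt_totalSpace _ _).1 hW).2
  have hφ := ((mdifferentiableAt_totalSpace _ _).1 hW).1
  have ev := hφ.continuousAt.eventually
    ((trivializationAt E' (TangentSpace I' : N → Type _) (φ p)).open_baseSet.mem_nhds
      (FiberBundle.mem_baseSet_trivializationAt' _))
  have key := mvfderiv_congr I (f := fun q ↦ (trivializationAt E' (TangentSpace I' : N → Type _)
    (φ p) (⟨φ q, V q + W q⟩ : TangentBundle I' N)).2) (by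
      filter_upwards [ev] with q hq
      exact ((Trivialization.continuousLinearMapAt_apply_of_mem (R := ℝ) _ hq _).symm.trans
        (map_add _ _ _)).trans (congrArg₂ _
          (Trivialization.continuousLinearMapAt_apply_of_mem (R := ℝ) _ hq _)
          (Trivialization.continuousLinearMapAt_apply_of_mem (R := ℝ) _ hq _))) |>.trans
    (mvfderiv_fun_add hV' hW')
  have h1 := leviCivita_extend_comb I' 1 1 (V p) (W p)
  simp only [one_smul] at h1
  unfold inducedDeriv
  rw [h1, key]
  simp only [add_apply, map_add]
  abel

theorem inducedDeriv_smul {φ : M → N} {p : M} {f : M → ℝ} {V : Π p : M, TangentSpace I' (φ p)}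
    (hf : MDiffAt f p)
    (hV : MDifferentiableAt I (I'.prod 𝓘(ℝ, E')) (fun q ↦ (⟨φ q, V q⟩ : TangentBundle I' N)) p)
    (v : TangentSpace I p) :
    inducedDeriv I I' φ (fun q ↦ f q • V q) p v =
      f p • inducedDeriv I I' φ V p v + mvfderiv I f p v • V p := by
  have hV' := ((mdifferentiableAt_totalSpace _ _).1 hV).2
  have hφ := ((mdifferentiableAt_totalSpace _ _).1 hV).1
  have hp := FiberBundle.mem_baseSet_trivializationAt' (F := E')
    (E := (TangentSpace I' : N → Type _)) (φ p)
  have ev := hφ.continuousAt.eventually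
    ((trivializationAt E' (TangentSpace I' : N → Type _) (φ p)).open_baseSet.mem_nhds hp)
  have key := mvfderiv_congr I (f := fun q ↦ (trivializationAt E' (TangentSpace I' : N → Type _)
    (φ p) (⟨φ q, f q • V q⟩ : TangentBundle I' N)).2) (by
      filter_upwards [ev] with q hq
      exact ((Trivialization.continuousLinearMapAt_apply_of_mem (R := ℝ) _ hq _).symm.trans
        (map_smul _ _ _)).trans (congrArg _
          (Trivialization.continuousLinearMapAt_apply_of_mem (R := ℝ) _ hq _))) |>.trans
    (mvfderiv_fun_smul hf hV')
  have h1 := leviCivita_extend_comb I' (f p) 0 (V p) 0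
  simp only [zero_smul, add_zero] at h1
  unfold inducedDeriv
  rw [h1, key]
  simp only [add_apply, smul_apply, map_add, map_smul, ContinuousLinearMap.smulRight_apply]
  have h2 : (trivializationAt E' (TangentSpace I' : N → Type _) (φ p)).symmL ℝ (φ p)
      (trivializationAt E' (TangentSpace I' : N → Type _) (φ p)
        (⟨φ p, V p⟩ : TangentBundle I' N)).2 = V p := by
    rw [← Trivialization.continuousLinearMapAt_apply_of_mem (R := ℝ) _ hp,
      Trivialization.symmL_continuousLinearMapAt _ hp]
  rw [h2, smul_add]
  abel

/-- The characteristic property of the induced connection: `∇̄_v (Z ∘ φ) = ∇_{dφ v} Z`. -/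
theorem inducedDeriv_comp {φ : M → N} {p : M} {Z : Π y : N, TangentSpace I' y}
    (hφ : MDifferentiableAt I I' φ p) (hZ : MDiffAt (T% Z) (φ p)) (v : TangentSpace I p) :
    inducedDeriv I I' φ (fun q ↦ Z (φ q)) p v
      = leviCivita I' Z (φ p) (mfderiv I I' φ p v) := by
  have hc := (leviCivita I' (M := N)).isCovariantDerivativeOn (s := Set.univ)
  have hcomp {W : Π y : N, TangentSpace I' y} (hW : MDiffAt (T% W) (φ p)) :
      MDifferentiableAt I (I'.prod 𝓘(ℝ, E')) (fun q ↦ (⟨φ q, W (φ q)⟩ : TangentBundle I' N)) p :=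
    MDifferentiableAt.comp p hW hφ
  have ht : TensorialAt I' E' (fun W : Π y : N, TangentSpace I' y ↦
      inducedDeriv I I' φ (fun q ↦ W (φ q)) p v
        - leviCivita I' W (φ p) (mfderiv I I' φ p v)) (φ p) := by
    constructor
    · intro f W hf hW
      have h1 := inducedDeriv_smul I I' (f := f ∘ φ) (hf.comp p hφ) (hcomp hW) v
      have h2 := hc.leibniz hW hf
      have h3 := mvfderiv_comp_apply p hf hφ v
      simp only [Pi.smul_apply'] 
      rw [h2]
      refine (congrArg₂ _ h1 rfl).trans ?_
      rw [h3]
      simp [smul_sub]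
    · intro W W' hW hW'
      have h1 := inducedDeriv_add I I' (hcomp hW) (hcomp hW') v
      have h2 := hc.add hW hW'
      simp only [Pi.add_apply]
      rw [h2, h1]
      simp only [add_apply]
      abel
  have hext := FiberBundle.mdifferentiableAt_extend I' E' (Z (φ p))
  have h := ht.pointwise hZ hext (by simp)
  have h0 : inducedDeriv I I' φ (fun q ↦ FiberBundle.extend E' (Z (φ p)) (φ q)) p v
      = leviCivita I' (FiberBundle.extend E' (Z (φ p))) (φ p) (mfderiv I I' φ p v) := by
    have hp := FiberBundle.mem_baseSet_trivializationAt' (F := E')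
      (E := (TangentSpace I' : N → Type _)) (φ p)
    have ev := hφ.continuousAt.eventually
      ((trivializationAt E' (TangentSpace I' : N → Type _) (φ p)).open_baseSet.mem_nhds hp)
    have key := mvfderiv_congr I (f := fun q ↦ (trivializationAt E' (TangentSpace I' : N → Type _)
      (φ p) (⟨φ q, FiberBundle.extend E' (Z (φ p)) (φ q)⟩ : TangentBundle I' N)).2)
      (g := fun _ ↦ (trivializationAt E' (TangentSpace I' : N → Type _) (φ p)
        (⟨φ p, Z (φ p)⟩ : TangentBundle I' N)).2) (p := p) (by
        filter_upwards [ev] with q hq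
        simp only [FiberBundle.extend]
        rw [Trivialization.apply_mk_symm _ hq])
    unfold inducedDeriv
    rw [key, mvfderiv_const]
    simp
  rw [h0, sub_self, sub_eq_zero] at h
  exact h

theorem mdifferentiableAt_push {φ : M → N} (hφ : ContMDiff I I' ∞ φ) {p : M}
    {Y : Π p : M, TangentSpace I p} (hY : MDiffAt (T% Y) p) :
    MDifferentiableAt I (I'.prod 𝓘(ℝ, E'))
      (fun q ↦ (⟨φ q, mfderiv I I' φ q (Y q)⟩ : TangentBundle I' N)) p :=
  MDifferentiableAt.comp p
    ((hφ.contMDiff_tangentMap (m := 1) (by norm_cast)).mdifferentiableAt one_ne_zero) hY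

theorem secondFundamentalForm_tensorial_right {φ : M → N} (hφ : ContMDiff I I' ∞ φ) (p : M)
    (X : Π p : M, TangentSpace I p) :
    TensorialAt I E (fun Y ↦ secondFundamentalForm I I' φ X Y p) p where
  smul {f Y} hf hY := by
    have h1 := inducedDeriv_smul I I' hf (mdifferentiableAt_push I I' hφ hY) (X p)
    have h2 := (leviCivita I (M := M)).isCovariantDerivativeOn.leibniz hY hf
    simp only [secondFundamentalForm, Pi.smul_apply', map_smul]
    rw [h1, h2]
    simp [smul_sub]
  add {Y Y'} hY hY' := by
    have h1 := inducedDeriv_add I I' (mdifferentiableAt_push I I' hφ hY)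
      (mdifferentiableAt_push I I' hφ hY') (X p)
    have h2 := (leviCivita I (M := M)).isCovariantDerivativeOn.add hY hY'
    simp only [secondFundamentalForm, Pi.add_apply, map_add]
    rw [h1, h2]
    simp only [add_apply, map_add]
    abel

theorem secondFundamentalForm_tensorial_left (φ : M → N) (p : M)
    (Y : Π p : M, TangentSpace I p) :
    TensorialAt I E (fun X ↦ secondFundamentalForm I I' φ X Y p) p where
  smul {f X} hf hX := by
    simp only [secondFundamentalForm, inducedDeriv, Pi.smul_apply', map_smul, smul_sub, smul_add]
  add {X X'} hX hX' := by
    simp only [secondFundamentalForm, inducedDeriv, Pi.add_apply, map_add]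
    abel

theorem sum_bilin_orthonormalBasis {V W ι κ : Type*} [NormedAddCommGroup V]
    [InnerProductSpace ℝ V] [AddCommGroup W] [Module ℝ W] [TopologicalSpace W]
    [IsTopologicalAddGroup W] [ContinuousConstSMul ℝ W] [Fintype ι] [Fintype κ]
    (B : V →L[ℝ] V →L[ℝ] W) (b : OrthonormalBasis ι ℝ V) (c : OrthonormalBasis κ ℝ V) :
    ∑ i, B (b i) (b i) = ∑ j, B (c j) (c j) := by
  have h1 (i) : B (b i) (b i) = ∑ j, (inner ℝ (c j) (b i) : ℝ) • B (c j) (b i) := by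
    conv_lhs => enter [1]; rw [← c.sum_repr' (b i)]
    simp
  have h2 (j) : B (c j) (c j) = ∑ i, (inner ℝ (c j) (b i) : ℝ) • B (c j) (b i) := by
    conv_lhs => enter [2]; rw [← b.sum_repr' (c j)]
    simp [real_inner_comm]
  simp only [h1, h2]
  exact Finset.sum_comm

/-- The tension field is `∑ i, B(φ)(e_i, e_i)` for every orthonormal frame field `e_i`. -/
theorem tensionField_eq_sum {φ : M → N} (hφ : ContMDiff I I' ∞ φ) {p : M} {ι : Type*} [Fintype ι]
    {e : ι → Π p : M, TangentSpace I p} (he : ∀ i, MDiffAt (T% (e i)) p)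
    (ho : Orthonormal ℝ (fun i ↦ e i p)) (hcard : Fintype.card ι = Module.finrank ℝ E) :
    tensionField I I' φ p = ∑ i, secondFundamentalForm I I' φ (e i) (e i) p := by
  let B : TangentSpace I p →L[ℝ] TangentSpace I p →L[ℝ] TangentSpace I' (φ p) :=
    TensorialAt.mkHom₂ (fun X Y ↦ secondFundamentalForm I I' φ X Y p) p
      (fun Y _ ↦ secondFundamentalForm_tensorial_left I I' φ p Y)
      (fun X _ ↦ secondFundamentalForm_tensorial_right I I' hφ p X)
  have hB (X Y : Π p : M, TangentSpace I p) (hX : MDiffAt (T% X) p) (hY : MDiffAt (T% Y) p) :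
      secondFundamentalForm I I' φ X Y p = B (X p) (Y p) :=
    (TensorialAt.mkHom₂_apply (Φ := fun X Y ↦ secondFundamentalForm I I' φ X Y p) _ _ hX hY).symm
  have hspan : ⊤ ≤ Submodule.span ℝ (Set.range fun i ↦ e i p) :=
    (ho.linearIndependent.span_eq_top_of_card_eq_finrank' hcard).ge
  have hs := sum_bilin_orthonormalBasis B (stdOrthonormalBasis ℝ (TangentSpace I p))
    (OrthonormalBasis.mk ho hspan)
  simp only [OrthonormalBasis.coe_mk] at hs
  unfold tensionField
  simp only [hB _ _ (he _) (he _)]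
  rw [← hs]
  refine Finset.sum_congr rfl fun i _ ↦ ?_
  rw [hB _ _ (FiberBundle.mdifferentiableAt_extend I E _)
    (FiberBundle.mdifferentiableAt_extend I E _), FiberBundle.extend_apply_self]

end Tension

section Submersion

variable {E : Type*} [NormedAddCommGroup E] [NormedSpace ℝ E]
  {H : Type*} [TopologicalSpace H] (I : ModelWithCorners ℝ E H)
  {P : Type*} [TopologicalSpace P] [ChartedSpace H P] [IsManifold I ∞ P]
  [RiemannianBundle (fun x : P ↦ TangentSpace I x)]
  {E' : Type*} [NormedAddCommGroup E'] [NormedSpace ℝ E']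
  {H' : Type*} [TopologicalSpace H'] (I' : ModelWithCorners ℝ E' H')
  {M : Type*} [TopologicalSpace M] [ChartedSpace H' M] [IsManifold I' ∞ M]
  [RiemannianBundle (fun x : M ↦ TangentSpace I' x)]

/-- The vertical subspace `Ker dφ_u` of `T_u P`. -/
def vertical (φ : P → M) (u : P) : Submodule ℝ (TangentSpace I u) :=
  LinearMap.ker (mfderiv I I' φ u).toLinearMap

/-- The horizontal subspace of `T_u P`: the orthogonal complement of the vertical subspace. -/
def horizontal (φ : P → M) (u : P) : Submodule ℝ (TangentSpace I u) :=
  (vertical I I' φ u)ᗮ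

/-- A Riemannian submersion: a smooth surjective map with surjective differentials that are
isometric on the horizontal subspaces. -/
structure IsRiemannianSubmersion (φ : P → M) : Prop where
  contMDiff : ContMDiff I I' ∞ φ
  surjective : Function.Surjective φ
  mfderiv_surjective : ∀ u, Function.Surjective (mfderiv I I' φ u)
  isometry : ∀ u, ∀ v ∈ horizontal I I' φ u, ∀ w ∈ horizontal I I' φ u,
    (inner ℝ (mfderiv I I' φ u v) (mfderiv I I' φ u w) : ℝ) = inner ℝ v w

/-- An adapted local orthonormal frame field `e_1, …, e_n, e_{n+1}` on the open set `U`
(the vertical field `e_{n+1}` is `e (Fin.last n)`), for a submersion with one-dimensional fibres.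
The fields `e_1, …, e_n` are basic: they are horizontal and `φ`-related to the orthonormal frame
field `ε_1, …, ε_n` on the open set `V` of the base. -/
structure IsAdaptedFrame {n : ℕ} (φ : P → M) (U : Set P) (V : Set M)
    (e : Fin (n + 1) → Π u : P, TangentSpace I u) (ε : Fin n → Π x : M, TangentSpace I' x) :
    Prop where
  isOpen_source : IsOpen U
  isOpen_target : IsOpen V
  mapsTo : Set.MapsTo φ U V
  contMDiffOn : ∀ i, ContMDiffOn I I.tangent ∞ (fun u ↦ (⟨u, e i u⟩ : TangentBundle I P)) U
  orthonormal : ∀ u ∈ U, Orthonormal ℝ fun i ↦ e i u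
  mem_horizontal : ∀ u ∈ U, ∀ i : Fin n, e i.castSucc u ∈ horizontal I I' φ u
  mem_vertical : ∀ u ∈ U, e (Fin.last n) u ∈ vertical I I' φ u
  contMDiffOn_base :
    ∀ i, ContMDiffOn I' I'.tangent ∞ (fun x ↦ (⟨x, ε i x⟩ : TangentBundle I' M)) V
  orthonormal_base : ∀ x ∈ V, Orthonormal ℝ fun i ↦ ε i x
  related : ∀ u ∈ U, ∀ i : Fin n, mfderiv I I' φ u (e i.castSucc u) = ε i (φ u)

end Submersion

end RiemSub

end

noncomputable section

namespace RiemSub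

set_option linter.unusedSectionVars false

section Bracket

open VectorField

variable {E : Type*} [NormedAddCommGroup E] [NormedSpace ℝ E]
  {H : Type*} [TopologicalSpace H] {I : ModelWithCorners ℝ E H}
  {M : Type*} [TopologicalSpace M] [ChartedSpace H M]
  {F : Type*} [NormedAddCommGroup F] [NormedSpace ℝ F]
  {E' : Type*} [NormedAddCommGroup E'] [NormedSpace ℝ E']
  {H' : Type*} [TopologicalSpace H'] {I' : ModelWithCorners ℝ E' H'}
  {N : Type*} [TopologicalSpace N] [ChartedSpace H' N]

theorem mvfderiv_congr_of_eventuallyEq {f g : M → F} {x : M} (h : f =ᶠ[nhds x] g) :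
    mvfderiv I f x = mvfderiv I g x := by
  ext v
  exact congrArg (fun L : E →L[ℝ] F ↦ L v) h.mfderiv_eq

theorem mvfderiv_comp_apply' {φ : M → N} {x : M} {g : N → F} (hg : MDiffAt g (φ x))
    (hφ : MDiffAt φ x) (v : TangentSpace I x) :
    mvfderiv I (g ∘ φ) x v = mvfderiv I' g (φ x) (mfderiv I I' φ x v) :=
  congrArg (fun L : E →L[ℝ] F ↦ L v) (mfderiv_comp x hg hφ)

variable [I.Boundaryless] [I'.Boundaryless] [IsManifold I ∞ M] [IsManifold I' ∞ N]

/-- In the chart at `x`, the derivative of a function along a vector field is the derivative of its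
chart expression along the pulled back field. -/
theorem fderiv_comp_extChartAt_symm_apply_mpullbackWithin {x : M} {y : E}
    (hy : y ∈ (extChartAt I x).target) {g : M → F} (hg : MDiffAt g ((extChartAt I x).symm y))
    (W : Π x : M, TangentSpace I x) :
    fderiv ℝ (g ∘ (extChartAt I x).symm) y
        (mpullbackWithin 𝓘(ℝ, E) I (extChartAt I x).symm W (Set.range I) y) =
      mvfderiv I g ((extChartAt I x).symm y) (W ((extChartAt I x).symm y)) := by
  have hinv := isInvertible_mfderivWithin_extChartAt_symm (I := I) hy
  have hs := mdifferentiableWithinAt_extChartAt_symm (I := I) hy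
  rw [mpullbackWithin_apply]
  rw [I.range_eq_univ] at hinv hs ⊢
  have h := mfderiv_comp_mfderivWithin y hg hs (uniqueMDiffWithinAt_univ _)
  rw [mfderivWithin_univ, mfderiv_eq_fderiv] at h
  refine (congrArg (fun L : E →L[ℝ] F ↦ L _) h).trans ?_
  exact congrArg (mvfderiv I g ((extChartAt I x).symm y))
    (ContinuousLinearMap.IsInvertible.self_apply_inverse hinv _)

theorem contDiffAt_comp_extChartAt_symm {x : M} {f : M → F} {n : ℕ∞ω} (hf : CMDiffAt n f x) :
    ContDiffAt ℝ n (f ∘ (extChartAt I x).symm) (extChartAt I x x) := by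
  have h := (contMDiffAt_iff.1 hf).2
  rw [I.range_eq_univ, contDiffWithinAt_univ] at h
  exact h

theorem differentiableAt_mpullbackWithin_extChartAt_symm [CompleteSpace E] {x : M}
    {W : Π x : M, TangentSpace I x} (hW : MDiffAt (T% W) x) :
    DifferentiableAt ℝ (mpullbackWithin 𝓘(ℝ, E) I (extChartAt I x).symm W (Set.range I))
      (extChartAt I x x) := by
  have h := (mdifferentiableWithinAt_univ.2 hW).differentiableWithinAt_mpullbackWithin_vectorField
  rw [Set.preimage_univ, Set.univ_inter] at h
  exact h.differentiableAt (by simp [I.range_eq_univ])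

theorem eventuallyEq_mvfderiv_apply {x : M} {f : M → F} (hf : CMDiffAt 2 f x)
    (W : Π x : M, TangentSpace I x) :
    (fun q ↦ mvfderiv I f q (W q)) ∘ (extChartAt I x).symm =ᶠ[nhds (extChartAt I x x)]
      fun y ↦ fderiv ℝ (f ∘ (extChartAt I x).symm) y
        (mpullbackWithin 𝓘(ℝ, E) I (extChartAt I x).symm W (Set.range I) y) := by
  have : IsManifold I 2 M := .of_le (n := ∞) (by norm_cast)
  have h := (continuousAt_extChartAt_symm (I := I) x).eventually
    (show ∀ᶠ q in nhds ((extChartAt I x).symm (extChartAt I x x)), CMDiffAt 2 f q by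
      rw [extChartAt_to_inv]
      exact (contMDiffAt_iff_contMDiffAt_nhds (by norm_cast)).1 hf)
  filter_upwards [h, extChartAt_target_mem_nhds x] with y hy hyt
  exact (fderiv_comp_extChartAt_symm_apply_mpullbackWithin hyt
    (hy.mdifferentiableAt two_ne_zero) W).symm

theorem mdifferentiableAt_mvfderiv_apply [CompleteSpace E] {x : M} {f : M → F}
    (hf : CMDiffAt 2 f x) {W : Π x : M, TangentSpace I x} (hW : MDiffAt (T% W) x) :
    MDiffAt (fun q ↦ mvfderiv I f q (W q)) x := by
  have hd : DifferentiableAt ℝ (fun y ↦ fderiv ℝ (f ∘ (extChartAt I x).symm) y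
      (mpullbackWithin 𝓘(ℝ, E) I (extChartAt I x).symm W (Set.range I) y)) (extChartAt I x x) :=
    ((contDiffAt_comp_extChartAt_symm hf).fderiv_right (m := 1)
      (by norm_num [one_add_one_eq_two])).differentiableAt one_ne_zero |>.clm_apply
      (differentiableAt_mpullbackWithin_extChartAt_symm hW)
  have hc := MDifferentiableAt.comp x
    (((eventuallyEq_mvfderiv_apply hf W).differentiableAt_iff.2 hd).mdifferentiableAt)
    (mdifferentiableAt_extChartAt (I := I) (ChartedSpace.mem_chart_source x))
  refine hc.congr_of_eventuallyEq ?_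
  filter_upwards [extChartAt_source_mem_nhds (I := I) x] with q hq
  exact (congrArg (fun q ↦ mvfderiv I f q (W q)) ((extChartAt I x).left_inv hq)).symm

/-- The derivative along `[V, W]` is the commutator of the derivatives along `V` and `W`. -/
theorem mvfderiv_mlieBracket [CompleteSpace E] {x : M} {f : M → F} (hf : CMDiffAt 2 f x)
    {V W : Π x : M, TangentSpace I x} (hV : MDiffAt (T% V) x) (hW : MDiffAt (T% W) x) :
    mvfderiv I f x (mlieBracket I V W x) =
      mvfderiv I (fun q ↦ mvfderiv I f q (W q)) x (V x)
        - mvfderiv I (fun q ↦ mvfderiv I f q (V q)) x (W x) := by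
  have hx := mem_extChartAt_target (I := I) x
  have key {G : M → F} (hG : MDiffAt G x) (Z : Π x : M, TangentSpace I x) :
      fderiv ℝ (G ∘ (extChartAt I x).symm) (extChartAt I x x)
        (mpullbackWithin 𝓘(ℝ, E) I (extChartAt I x).symm Z (Set.range I) (extChartAt I x x)) =
      mvfderiv I G x (Z x) := by
    have h := fderiv_comp_extChartAt_symm_apply_mpullbackWithin hx (g := G)
      (by rwa [extChartAt_to_inv]) Z
    rwa [extChartAt_to_inv] at h
  have hb := fderiv_apply_lieBracket (contDiffAt_comp_extChartAt_symm hf) (by simp)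
    (differentiableAt_mpullbackWithin_extChartAt_symm hW)
    (differentiableAt_mpullbackWithin_extChartAt_symm hV)
  rw [← (eventuallyEq_mvfderiv_apply hf W).fderiv_eq,
    ← (eventuallyEq_mvfderiv_apply hf V).fderiv_eq,
    key (mdifferentiableAt_mvfderiv_apply hf hW), key (mdifferentiableAt_mvfderiv_apply hf hV)]
    at hb
  have hfx : f ∘ (extChartAt I x).symm ∘ extChartAt I x =ᶠ[nhds x] f := by
    filter_upwards [extChartAt_source_mem_nhds (I := I) x] with q hq
    exact congrArg f ((extChartAt I x).left_inv hq)
  have hL (v : TangentSpace I x) : mvfderiv I f x v =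
      fderiv ℝ (f ∘ (extChartAt I x).symm) (extChartAt I x x) (mfderiv% (extChartAt I x) x v) := by
    rw [← mvfderiv_congr_of_eventuallyEq hfx, ← Function.comp_assoc, mvfderiv_comp_apply'
      ((contDiffAt_comp_extChartAt_symm hf).differentiableAt two_ne_zero).mdifferentiableAt
      (mdifferentiableAt_extChartAt (I := I) (ChartedSpace.mem_chart_source x))]
    exact congrArg (fun L : E →L[ℝ] F ↦ L _) mfderiv_eq_fderiv
  rw [← hb, hL]
  refine congrArg _ ((ContinuousLinearMap.IsInvertible.self_apply_inverse
    (isInvertible_mfderiv_extChartAt (mem_extChartAt_source (I := I) x)) _).trans ?_)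
  rw [Set.preimage_univ, Set.univ_inter, I.range_eq_univ]
  exact congrFun (lieBracketWithin_univ (E := E)) _

/-- Brackets of `φ`-related vector fields are `φ`-related. -/
theorem mfderiv_mlieBracket_of_related [CompleteSpace E] [CompleteSpace E']
    {φ : M → N} {x : M} (hφ : CMDiffAt 2 φ x)
    {V W : Π x : M, TangentSpace I x} {V' W' : Π y : N, TangentSpace I' y}
    (hV : MDiffAt (T% V) x) (hW : MDiffAt (T% W) x)
    (hV' : MDiffAt (T% V') (φ x)) (hW' : MDiffAt (T% W') (φ x))
    (hVV' : ∀ᶠ q in nhds x, mfderiv I I' φ q (V q) = V' (φ q))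
    (hWW' : ∀ᶠ q in nhds x, mfderiv I I' φ q (W q) = W' (φ q)) :
    mfderiv I I' φ x (mlieBracket I V W x) = mlieBracket I' V' W' (φ x) := by
  have : IsManifold I 2 M := .of_le (n := ∞) (by norm_cast)
  have : IsManifold I' 2 N := .of_le (n := ∞) (by norm_cast)
  have hψ : CMDiffAt 2 (extChartAt I' (φ x)) (φ x) := contMDiffAt_extChartAt
  have hφd := hφ.mdifferentiableAt two_ne_zero
  apply (isInvertible_mfderiv_extChartAt (mem_extChartAt_source (I := I') (φ x))).injective
  change mvfderiv I' (extChartAt I' (φ x)) (φ x) _ = mvfderiv I' (extChartAt I' (φ x)) (φ x) _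
  have hrel {Z : Π x : M, TangentSpace I x} {Z' : Π y : N, TangentSpace I' y}
      (hZ : ∀ᶠ q in nhds x, mfderiv I I' φ q (Z q) = Z' (φ q)) :
      (fun q ↦ mvfderiv I (extChartAt I' (φ x) ∘ φ) q (Z q)) =ᶠ[nhds x]
        (fun y ↦ mvfderiv I' (extChartAt I' (φ x)) y (Z' y)) ∘ φ := by
    filter_upwards [hZ, (contMDiffAt_iff_contMDiffAt_nhds (by norm_cast)).1 hφ,
      hφd.continuousAt.eventually ((contMDiffAt_iff_contMDiffAt_nhds (by norm_cast)).1 hψ)]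
      with q hq hφq hψq
    rw [mvfderiv_comp_apply' (hψq.mdifferentiableAt two_ne_zero)
      (hφq.mdifferentiableAt two_ne_zero), hq]
    rfl
  rw [← mvfderiv_comp_apply' (hψ.mdifferentiableAt two_ne_zero) hφd,
    mvfderiv_mlieBracket (hψ.comp x hφ) hV hW, mvfderiv_mlieBracket hψ hV' hW',
    mvfderiv_congr_of_eventuallyEq (hrel hVV'), mvfderiv_congr_of_eventuallyEq (hrel hWW'),
    mvfderiv_comp_apply' (mdifferentiableAt_mvfderiv_apply hψ hW') hφd,
    mvfderiv_comp_apply' (mdifferentiableAt_mvfderiv_apply hψ hV') hφd,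
    hVV'.self_of_nhds, hWW'.self_of_nhds]

end Bracket

section UnitFields

variable {E : Type*} [NormedAddCommGroup E] [NormedSpace ℝ E] [FiniteDimensional ℝ E]
  {H : Type*} [TopologicalSpace H] {I : ModelWithCorners ℝ E H}
  {M : Type*} [TopologicalSpace M] [ChartedSpace H M] [IsManifold I ∞ M]
  [RiemannianBundle (fun x : M ↦ TangentSpace I x)]
  [IsContMDiffRiemannianBundle I ∞ E (fun x : M ↦ TangentSpace I x)]

theorem mvfderiv_eq_zero_of_eventually_const {f : M → ℝ} {x : M} {c : ℝ}
    (h : ∀ᶠ y in nhds x, f y = c) : mvfderiv I f x = 0 := by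
  rw [mvfderiv_congr_of_eventuallyEq (g := fun _ ↦ c) h, mvfderiv_const]

/-- `g(∇_X X, Z) = g([Z, X], X)` if `g(X, X)` and `g(X, Z)` are locally constant. -/
theorem inner_leviCivita_self {x : M} {X Z : Π x : M, TangentSpace I x}
    (hX : MDiffAt (T% X) x) (hZ : MDiffAt (T% Z) x) {a b : ℝ}
    (hXX : ∀ᶠ y in nhds x, (inner ℝ (X y) (X y) : ℝ) = a)
    (hXZ : ∀ᶠ y in nhds x, (inner ℝ (X y) (Z y) : ℝ) = b) :
    (inner ℝ (leviCivita I X x (X x)) (Z x) : ℝ) =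
      inner ℝ (VectorField.mlieBracket I Z X x) (X x) := by
  have hZX : ∀ᶠ y in nhds x, (inner ℝ (Z y) (X y) : ℝ) = b := by
    filter_upwards [hXZ] with y hy
    rw [real_inner_comm, hy]
  refine (inner_leviCivitaFun I hX hX hZ).trans ?_
  rw [koszul, mvfderiv_eq_zero_of_eventually_const hXX, mvfderiv_eq_zero_of_eventually_const hXZ,
    mvfderiv_eq_zero_of_eventually_const hZX, VectorField.mlieBracket_self,
    VectorField.mlieBracket_swap_apply (V := X) (W := Z)]
  simp only [zero_apply, Pi.zero_apply, inner_zero_left, inner_neg_left]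
  ring

theorem contMDiffAt_inner {x : M} {Y Z : Π x : M, TangentSpace I x}
    (hY : CMDiffAt ∞ (T% Y) x) (hZ : CMDiffAt ∞ (T% Z) x) :
    CMDiffAt ∞ (fun y ↦ (inner ℝ (Y y) (Z y) : ℝ)) x :=
  ContMDiffAt.inner_bundle (IB := I) (F := E) (E := fun x : M ↦ TangentSpace I x)
    (b := fun y ↦ y) (v := Y) (w := Z) hY hZ

end UnitFields

section InducedConnection

variable {E : Type*} [NormedAddCommGroup E] [NormedSpace ℝ E] [FiniteDimensional ℝ E]
  {H : Type*} [TopologicalSpace H] {I : ModelWithCorners ℝ E H}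
  {M : Type*} [TopologicalSpace M] [ChartedSpace H M] [IsManifold I ∞ M]
  [RiemannianBundle (fun x : M ↦ TangentSpace I x)]
  [IsContMDiffRiemannianBundle I ∞ E (fun x : M ↦ TangentSpace I x)]
  {E' : Type*} [NormedAddCommGroup E'] [NormedSpace ℝ E'] [FiniteDimensional ℝ E']
  {H' : Type*} [TopologicalSpace H'] {I' : ModelWithCorners ℝ E' H'}
  {N : Type*} [TopologicalSpace N] [ChartedSpace H' N] [IsManifold I' ∞ N]
  [RiemannianBundle (fun x : N ↦ TangentSpace I' x)]
  [IsContMDiffRiemannianBundle I' ∞ E' (fun x : N ↦ TangentSpace I' x)]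

theorem inducedDeriv_congr {φ : M → N} {p : M} {V W : Π p : M, TangentSpace I' (φ p)}
    (h : ∀ᶠ q in nhds p, V q = W q) (v : TangentSpace I p) :
    inducedDeriv I I' φ V p v = inducedDeriv I I' φ W p v := by
  unfold inducedDeriv
  rw [h.self_of_nhds, mvfderiv_congr_of_eventuallyEq (I := I) (x := p)]
  filter_upwards [h] with q hq
  rw [hq]

/-- `B(φ)(X, Y) = ∇_{dφ X} Z - dφ(∇_X Y)` if `Y` is `φ`-related to `Z`. -/
theorem secondFundamentalForm_of_related {φ : M → N} {p : M} (hφ : MDifferentiableAt I I' φ p)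
    {X Y : Π p : M, TangentSpace I p} {Z : Π y : N, TangentSpace I' y}
    (hZ : MDiffAt (T% Z) (φ p)) (h : ∀ᶠ q in nhds p, mfderiv I I' φ q (Y q) = Z (φ q)) :
    secondFundamentalForm I I' φ X Y p =
      leviCivita I' Z (φ p) (mfderiv I I' φ p (X p))
        - mfderiv I I' φ p (leviCivita I Y p (X p)) := by
  rw [secondFundamentalForm, inducedDeriv_congr h, inducedDeriv_comp I I' hφ hZ]

end InducedConnection

section AdaptedFrame

variable {n : ℕ}
  {E : Type*} [NormedAddCommGroup E] [NormedSpace ℝ E] [FiniteDimensional ℝ E]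
  {H : Type*} [TopologicalSpace H] {I : ModelWithCorners ℝ E H} [I.Boundaryless]
  {P : Type*} [TopologicalSpace P] [ChartedSpace H P] [IsManifold I ∞ P]
  [RiemannianBundle (fun x : P ↦ TangentSpace I x)]
  [IsContMDiffRiemannianBundle I ∞ E (fun x : P ↦ TangentSpace I x)]
  {E' : Type*} [NormedAddCommGroup E'] [NormedSpace ℝ E'] [FiniteDimensional ℝ E']
  {H' : Type*} [TopologicalSpace H'] {I' : ModelWithCorners ℝ E' H'} [I'.Boundaryless]
  {M : Type*} [TopologicalSpace M] [ChartedSpace H' M] [IsManifold I' ∞ M]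
  [RiemannianBundle (fun x : M ↦ TangentSpace I' x)]
  [IsContMDiffRiemannianBundle I' ∞ E' (fun x : M ↦ TangentSpace I' x)]
  {φ : P → M} {U : Set P} {V : Set M}
  {e : Fin (n + 1) → Π u : P, TangentSpace I u} {ε : Fin n → Π x : M, TangentSpace I' x} {u : P}

theorem IsRiemannianSubmersion.inner_mfderiv (hφ : IsRiemannianSubmersion I I' φ)
    (v : TangentSpace I u) {w : TangentSpace I u} (hw : w ∈ horizontal I I' φ u) :
    (inner ℝ (mfderiv I I' φ u v) (mfderiv I I' φ u w) : ℝ) = inner ℝ v w := by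
  obtain ⟨y, hy, z, hz, rfl⟩ := (vertical I I' φ u).exists_add_mem_mem_orthogonal v
  have hy' : mfderiv I I' φ u y = 0 := hy
  rw [map_add, hy', zero_add, hφ.isometry u z hz w hw, inner_add_left,
    Submodule.inner_right_of_mem_orthogonal hy hw, zero_add]

theorem sum_inner_smul_of_orthonormal {W ι : Type*} [NormedAddCommGroup W] [InnerProductSpace ℝ W]
    [FiniteDimensional ℝ W] [Fintype ι] {b : ι → W} (hb : Orthonormal ℝ b)
    (hcard : Fintype.card ι = Module.finrank ℝ W) (w : W) :
    ∑ i, (inner ℝ w (b i) : ℝ) • b i = w := by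
  have hspan : ⊤ ≤ Submodule.span ℝ (Set.range b) :=
    (hb.linearIndependent.span_eq_top_of_card_eq_finrank' hcard).ge
  have h := (OrthonormalBasis.mk hb hspan).sum_repr' w
  simpa only [OrthonormalBasis.coe_mk, real_inner_comm] using h

namespace IsAdaptedFrame

theorem mdifferentiableAt (he : IsAdaptedFrame I I' φ U V e ε) (hu : u ∈ U) (i : Fin (n + 1)) :
    MDiffAt (T% (e i)) u :=
  ((he.contMDiffOn i).contMDiffAt (he.isOpen_source.mem_nhds hu)).mdifferentiableAt (by simp)

theorem mdifferentiableAt_base (he : IsAdaptedFrame I I' φ U V e ε) (hu : u ∈ U) (i : Fin n) :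
    MDiffAt (T% (ε i)) (φ u) :=
  ((he.contMDiffOn_base i).contMDiffAt
    (he.isOpen_target.mem_nhds (he.mapsTo hu))).mdifferentiableAt (by simp)

theorem eventually_inner (he : IsAdaptedFrame I I' φ U V e ε) (hu : u ∈ U) (i j : Fin (n + 1)) :
    ∀ᶠ q in nhds u, (inner ℝ (e i q) (e j q) : ℝ) = if i = j then 1 else 0 := by
  filter_upwards [he.isOpen_source.mem_nhds hu] with q hq
  exact orthonormal_iff_ite.1 (he.orthonormal q hq) i j

theorem eventually_inner_base (he : IsAdaptedFrame I I' φ U V e ε) (hu : u ∈ U) (i j : Fin n) :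
    ∀ᶠ x in nhds (φ u), (inner ℝ (ε i x) (ε j x) : ℝ) = if i = j then 1 else 0 := by
  filter_upwards [he.isOpen_target.mem_nhds (he.mapsTo hu)] with x hx
  exact orthonormal_iff_ite.1 (he.orthonormal_base x hx) i j

theorem eventually_related (he : IsAdaptedFrame I I' φ U V e ε) (hu : u ∈ U) (i : Fin n) :
    ∀ᶠ q in nhds u, mfderiv I I' φ q (e i.castSucc q) = ε i (φ q) := by
  filter_upwards [he.isOpen_source.mem_nhds hu] with q hq using he.related q hq i

theorem eventually_related_last (he : IsAdaptedFrame I I' φ U V e ε) (hu : u ∈ U) :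
    ∀ᶠ q in nhds u, mfderiv I I' φ q (e (Fin.last n) q) =
      (0 : Π x : M, TangentSpace I' x) (φ q) := by
  filter_upwards [he.isOpen_source.mem_nhds hu] with q hq using he.mem_vertical q hq

theorem inner_mfderiv (he : IsAdaptedFrame I I' φ U V e ε) (hφ : IsRiemannianSubmersion I I' φ)
    (hu : u ∈ U) (i : Fin n) (v : TangentSpace I u) :
    (inner ℝ (mfderiv I I' φ u v) (ε i (φ u)) : ℝ) = inner ℝ v (e i.castSucc u) := by
  rw [← he.related u hu i, hφ.inner_mfderiv v (he.mem_horizontal u hu i)]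

theorem mfderiv_eq_sum (he : IsAdaptedFrame I I' φ U V e ε) (hφ : IsRiemannianSubmersion I I' φ)
    (hE' : Module.finrank ℝ E' = n) (hu : u ∈ U) (v : TangentSpace I u) :
    mfderiv I I' φ u v = ∑ i, (inner ℝ v (e (Fin.castSucc i) u) : ℝ) • ε i (φ u) := by
  refine (sum_inner_smul_of_orthonormal (he.orthonormal_base _ (he.mapsTo hu))
    ((Fintype.card_fin n).trans hE'.symm) _).symm.trans ?_
  exact Finset.sum_congr rfl fun i _ ↦ by rw [he.inner_mfderiv hφ hu]

/-- A vertical vector is a multiple of the vertical frame field. -/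
theorem eq_inner_smul_last (he : IsAdaptedFrame I I' φ U V e ε)
    (hφ : IsRiemannianSubmersion I I' φ) (hE : Module.finrank ℝ E = n + 1) (hu : u ∈ U)
    {v : TangentSpace I u} (hv : mfderiv I I' φ u v = 0) :
    v = (inner ℝ v (e (Fin.last n) u) : ℝ) • e (Fin.last n) u := by
  have h := sum_inner_smul_of_orthonormal (he.orthonormal u hu)
    ((Fintype.card_fin (n + 1)).trans hE.symm) v
  rw [Fin.sum_univ_castSucc, Finset.sum_eq_zero, zero_add] at h
  · exact h.symm
  · intro i _
    rw [← he.inner_mfderiv hφ hu, hv, inner_zero_left, zero_smul]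

theorem mfderiv_mlieBracket_last (he : IsAdaptedFrame I I' φ U V e ε)
    (hφ : IsRiemannianSubmersion I I' φ) (hu : u ∈ U) (i : Fin n) :
    mfderiv I I' φ u (VectorField.mlieBracket I (e i.castSucc) (e (Fin.last n)) u) = 0 := by
  have h0 : MDiffAt (T% (0 : Π x : M, TangentSpace I' x)) (φ u) :=
    mdifferentiableAt_zeroSection ..
  rw [mfderiv_mlieBracket_of_related ((hφ.contMDiff u).of_le (by norm_cast))
    (he.mdifferentiableAt hu _) (he.mdifferentiableAt hu _) (he.mdifferentiableAt_base hu i) h0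
    (he.eventually_related hu i) (he.eventually_related_last hu)]
  simp

theorem mfderiv_mlieBracket (he : IsAdaptedFrame I I' φ U V e ε)
    (hφ : IsRiemannianSubmersion I I' φ) (hu : u ∈ U) (i j : Fin n) :
    mfderiv I I' φ u (VectorField.mlieBracket I (e i.castSucc) (e j.castSucc) u) =
      VectorField.mlieBracket I' (ε i) (ε j) (φ u) :=
  mfderiv_mlieBracket_of_related ((hφ.contMDiff u).of_le (by norm_cast))
    (he.mdifferentiableAt hu _) (he.mdifferentiableAt hu _) (he.mdifferentiableAt_base hu i)
    (he.mdifferentiableAt_base hu j) (he.eventually_related hu i) (he.eventually_related hu j)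

theorem contMDiffOn_inner_mlieBracket (he : IsAdaptedFrame I I' φ U V e ε) (i j k : Fin (n + 1)) :
    ContMDiffOn I 𝓘(ℝ, ℝ) ∞
      (fun u ↦ (inner ℝ (VectorField.mlieBracket I (e i) (e j) u) (e k u) : ℝ)) U := by
  intro u hu
  have hm {i} := (he.contMDiffOn i).contMDiffAt (he.isOpen_source.mem_nhds hu)
  have : IsManifold I (((⊤ : ℕ∞) : ℕ∞ω) + 1) P := inferInstanceAs (IsManifold I ∞ P)
  have : IsManifold I (minSmoothness ℝ 2) P := .of_le (n := ∞) (by simp; norm_cast)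
  have hb := ContMDiffAt.mlieBracket_vectorField (m := ⊤) (n := ⊤) (hm (i := i)) (hm (i := j))
    (by simp)
  exact (contMDiffAt_inner hb hm).contMDiffWithinAt

theorem secondFundamentalForm_last (he : IsAdaptedFrame I I' φ U V e ε)
    (hφ : IsRiemannianSubmersion I I' φ) (hu : u ∈ U) :
    secondFundamentalForm I I' φ (e (Fin.last n)) (e (Fin.last n)) u =
      -mfderiv I I' φ u (leviCivita I (e (Fin.last n)) u (e (Fin.last n) u)) := by
  have hv : mfderiv I I' φ u (e (Fin.last n) u) = 0 := he.mem_vertical u hu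
  rw [secondFundamentalForm_of_related ((hφ.contMDiff u).mdifferentiableAt (by simp))
    (mdifferentiableAt_zeroSection ..) (he.eventually_related_last hu), hv, map_zero, zero_sub]

theorem secondFundamentalForm_castSucc (he : IsAdaptedFrame I I' φ U V e ε)
    (hφ : IsRiemannianSubmersion I I' φ) (hE' : Module.finrank ℝ E' = n) (hu : u ∈ U)
    (i : Fin n) :
    secondFundamentalForm I I' φ (e i.castSucc) (e i.castSucc) u = 0 := by
  rw [secondFundamentalForm_of_related ((hφ.contMDiff u).mdifferentiableAt (by simp))
    (he.mdifferentiableAt_base hu i) (he.eventually_related hu i), he.related u hu i, sub_eq_zero,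
    he.mfderiv_eq_sum hφ hE' hu]
  refine (sum_inner_smul_of_orthonormal (he.orthonormal_base _ (he.mapsTo hu))
    ((Fintype.card_fin n).trans hE'.symm) _).symm.trans (Finset.sum_congr rfl fun j _ ↦ ?_)
  rw [inner_leviCivita_self (he.mdifferentiableAt hu _) (he.mdifferentiableAt hu _)
      (he.eventually_inner hu _ _) (he.eventually_inner hu _ _),
    inner_leviCivita_self (he.mdifferentiableAt_base hu _) (he.mdifferentiableAt_base hu _)
      (he.eventually_inner_base hu _ _) (he.eventually_inner_base hu _ _),
    ← he.mfderiv_mlieBracket hφ hu, he.inner_mfderiv hφ hu]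

theorem tensionField_eq (he : IsAdaptedFrame I I' φ U V e ε)
    (hφ : IsRiemannianSubmersion I I' φ) (hE : Module.finrank ℝ E = n + 1)
    (hE' : Module.finrank ℝ E' = n) (hu : u ∈ U) :
    tensionField I I' φ u =
      -mfderiv I I' φ u (leviCivita I (e (Fin.last n)) u (e (Fin.last n) u)) := by
  rw [tensionField_eq_sum I I' hφ.contMDiff (he.mdifferentiableAt hu) (he.orthonormal u hu)
    ((Fintype.card_fin (n + 1)).trans hE.symm), Fin.sum_univ_castSucc,
    Finset.sum_eq_zero fun i _ ↦ he.secondFundamentalForm_castSucc hφ hE' hu i, zero_add,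
    he.secondFundamentalForm_last hφ hu]

theorem mfderiv_leviCivita_last (he : IsAdaptedFrame I I' φ U V e ε)
    (hφ : IsRiemannianSubmersion I I' φ) (hE' : Module.finrank ℝ E' = n) (hu : u ∈ U) :
    mfderiv I I' φ u (leviCivita I (e (Fin.last n)) u (e (Fin.last n) u)) =
      ∑ i : Fin n, (inner ℝ (VectorField.mlieBracket I (e i.castSucc) (e (Fin.last n)) u)
        (e (Fin.last n) u) : ℝ) • ε i (φ u) := by
  rw [he.mfderiv_eq_sum hφ hE' hu]
  refine Finset.sum_congr rfl fun i _ ↦ ?_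
  rw [inner_leviCivita_self (he.mdifferentiableAt hu _) (he.mdifferentiableAt hu _)
    (he.eventually_inner hu _ _) (he.eventually_inner hu _ _)]

end IsAdaptedFrame

end AdaptedFrame

end RiemSub

end

theorem theorem2p1 {n : ℕ}
    {P : Type*} [TopologicalSpace P] [ChartedSpace (EuclideanSpace ℝ (Fin (n + 1))) P]
    [IsManifold (𝓡 (n + 1)) ∞ P]
    [RiemannianBundle (fun u : P ↦ TangentSpace (𝓡 (n + 1)) u)]
    [IsContMDiffRiemannianBundle (𝓡 (n + 1)) ∞ (EuclideanSpace ℝ (Fin (n + 1)))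
      (fun u : P ↦ TangentSpace (𝓡 (n + 1)) u)]
    {M : Type*} [TopologicalSpace M] [ChartedSpace (EuclideanSpace ℝ (Fin n)) M]
    [IsManifold (𝓡 n) ∞ M]
    [RiemannianBundle (fun x : M ↦ TangentSpace (𝓡 n) x)]
    [IsContMDiffRiemannianBundle (𝓡 n) ∞ (EuclideanSpace ℝ (Fin n))
      (fun x : M ↦ TangentSpace (𝓡 n) x)]
    (φ : P → M) (hφ : RiemSub.IsRiemannianSubmersion (𝓡 (n + 1)) (𝓡 n) φ)
    (U : Set P) (V : Set M)
    (e : Fin (n + 1) → Π u : P, TangentSpace (𝓡 (n + 1)) u)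
    (ε : Fin n → Π x : M, TangentSpace (𝓡 n) x)
    (he : RiemSub.IsAdaptedFrame (𝓡 (n + 1)) (𝓡 n) φ U V e ε) :
    (∀ u ∈ U, RiemSub.tensionField (𝓡 (n + 1)) (𝓡 n) φ u =
      -mfderiv (𝓡 (n + 1)) (𝓡 n) φ u
        (RiemSub.leviCivita (𝓡 (n + 1)) (e (Fin.last n)) u (e (Fin.last n) u))) ∧
    ∃ κ : Fin n → P → ℝ,
      (∀ i, ContMDiffOn (𝓡 (n + 1)) 𝓘(ℝ, ℝ) ∞ (κ i) U) ∧
      (∀ u ∈ U, ∀ i, VectorField.mlieBracket (𝓡 (n + 1)) (e i.castSucc) (e (Fin.last n)) u =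
        κ i u • e (Fin.last n) u) ∧
      ∀ u ∈ U, -mfderiv (𝓡 (n + 1)) (𝓡 n) φ u
        (RiemSub.leviCivita (𝓡 (n + 1)) (e (Fin.last n)) u (e (Fin.last n) u)) =
          -∑ i, κ i u • ε i (φ u) := by
  have hP : Module.finrank ℝ (EuclideanSpace ℝ (Fin (n + 1))) = n + 1 := finrank_euclideanSpace_fin
  have hM : Module.finrank ℝ (EuclideanSpace ℝ (Fin n)) = n := finrank_euclideanSpace_fin
  exact ⟨fun u hu ↦ he.tensionField_eq hφ hP hM hu, _,
    fun i ↦ he.contMDiffOn_inner_mlieBracket i.castSucc (Fin.last n) (Fin.last n),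
    fun u hu i ↦ he.eq_inner_smul_last hφ hP hu (he.mfderiv_mlieBracket_last hφ hu i),
    fun u hu ↦ congrArg _ (he.mfderiv_leviCivita_last hφ hM hu)⟩
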